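/- An \emph{Ordinal Turing Machine (OTM) program} $P$ uses some finite number $k\geq 1$ of tapes, each with its own read-write head; the cells of each tape are indexed by the ordinals and contain symbols from $\{0,1\}$. $P$ has finitely many working states $0,1,\dots,N-1$ (all other natural numbers are halting states), and for every working state and every $k$-tuple of scanned symbols it has exactly one command, which specifies for each tape the symbol to be written on the scanned cell and whether the head of that tape moves left, stays, or moves right, and which specifies the next state. The computation of $P$ is indexed by ordinal times. At time $0$ the state is $0$, all heads are on cell $0$, and all cells contain $0$. At a successor time $t+1$ the configuration arises from that at time $t$ by executing the applicable command; a head that moves left from a cell $\xi+1$ goes to $\xi$, and a head that moves left from cell $0$ or from a cell with limit index goes to cell $0$. At a limit time, the state, each head position and the content of each cell are the inferior limits of their values at the earlier times. $P$ \emph{halts at time} $t$ if $t$ is the first time at which $P$ is in a halting state. An ordinal $\alpha$ is \emph{OTM-clockable} if there is an OTM program that halts at time $\alpha+1$. \textbf{Lemma.} Let $\alpha$ be an ordinal and $n\in\omega$. If $\alpha+n$ is OTM-clockable, then $\alpha$ is OTM-clockable. -/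

import Mathlib

universe u

/-- The possible movements of a read-write head in one step. -/
inductive HeadMove : Type
  | left
  | stay
  | right

/-- The command executed in one step by a machine with `k` tapes: for each tape the symbol to be
written on the scanned cell and the movement of the head of that tape, and the next state. -/
structure OTMCommand (k : ℕ) : Type where
  write : Fin k → Bool
  move : Fin k → HeadMove
  nextState : ℕ

/-- A (parameter-free) program for an Ordinal Turing Machine with finitely many tapes over the
alphabet `{0, 1}` (`false` is `0`, `true` is `1`), each with its own read-write head. The working
states are the natural numbers below `numStates`; every other natural number is a halting state.
For every working state and every tuple of scanned symbols there is exactly one command. -/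
structure OTMProgram : Type where
  numTapes : ℕ
  numTapes_pos : 0 < numTapes
  numStates : ℕ
  command : Fin numStates → (Fin numTapes → Bool) → OTMCommand numTapes

/-- A configuration of a machine with `k` tapes: the inner state, the head positions, and the
contents of the tapes, whose cells are indexed by the ordinals. -/
@[ext]
structure OTMConfig (k : ℕ) : Type (u + 1) where
  state : ℕ
  head : Fin k → Ordinal.{u}
  tape : Fin k → Ordinal.{u} → Bool

/-- The new position of a head. A head that moves to the left from a limit position, or
from position `0`, goes to position `0`. -/
noncomputable def HeadMove.apply (m : HeadMove) (p : Ordinal.{u}) : Ordinal.{u} :=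
  match m with
  | .left => Ordinal.limitRecOn p 0 (fun q _ => q) (fun _ _ _ => 0)
  | .stay => p
  | .right => p + 1

namespace OTMProgram

/-- The initial configuration: state `0`, all heads on position `0`, all cells contain `0`. -/
def init (P : OTMProgram) : OTMConfig.{u} P.numTapes where
  state := 0
  head _ := 0
  tape _ _ := false

open Classical in
/-- One step of the machine. A configuration in a halting state is left unchanged. -/
noncomputable def step (P : OTMProgram) (c : OTMConfig.{u} P.numTapes) :
    OTMConfig.{u} P.numTapes :=
  if h : c.state < P.numStates then
    let I := P.command ⟨c.state, h⟩ (fun i => c.tape i (c.head i))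
    { state := I.nextState
      head := fun i => (I.move i).apply (c.head i)
      tape := fun i => Function.update (c.tape i) (c.head i) (I.write i) }
  else c

/-- The configuration at a limit time: the inner state, each head position and each cell content
are the inferior limits of their values at the earlier times. -/
noncomputable def limitConfig {k : ℕ} {l : Ordinal.{u}} (c : Set.Iio l → OTMConfig.{u} k) :
    OTMConfig.{u} k where
  state := Filter.liminf (fun t => (c t).state) Filter.atTop
  head i := Filter.liminf (fun t => (c t).head i) Filter.atTop
  tape i x := Filter.liminf (fun t => (c t).tape i x) Filter.atTop

/-- The configuration at time `t` of the computation of `P` on empty tapes. -/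
noncomputable def run (P : OTMProgram) (t : Ordinal.{u}) : OTMConfig.{u} P.numTapes :=
  Ordinal.limitRecOn t P.init (fun _ c => P.step c) (fun _ _ c => limitConfig fun s => c s.1 s.2)

/-- `P` halts at time `t`: it is in a halting state at time `t`, and at no earlier time. -/
def HaltsAt (P : OTMProgram) (t : Ordinal.{u}) : Prop :=
  P.numStates ≤ (P.run t).state ∧ ∀ s < t, (P.run s).state < P.numStates

end OTMProgram

/-- `α` is OTM-clockable: some OTM-program halts at time `α + 1`. (A halting state is never
entered at a limit time, so the `+ 1` is what allows limit ordinals to be clockable.) -/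
def OTMClockable (α : Ordinal.{u}) : Prop :=
  ∃ P : OTMProgram, P.HaltsAt (α + 1)

/-! It suffices to remove one unit at a time: from a program `P` halting at time `α + 2`, build one
halting at `α + 1`. The new machine runs `P` in real time, but on enough tapes that the symbols
scanned at time `t` already determine the state of `P` at time `t + 2`. It can therefore stop one
step early.

Lookahead requires scanning the neighbours of each head. A second head kept one cell ahead fails:
when the main head converges to a limit `λ` from below, its companion also arrives at `λ`, not at `λ
+ 1`. So each tape is split into its residue classes mod 3, each with its own head at `window k p`.
This function of the position `p` is monotone and continuous at limits, so it commutes with inferior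
limits (`map_liminf_Iio`), and the three heads cover `p` and its neighbours. The first cell gets an
extra tape, as a left move from a limit leads there.

Steering the three heads takes some bits about `p` (`positionInfo`). They are marked on the cells
visited. A cell not visited before is reached at time `0`, by a move to the right (the bits are then
computed in advance and recorded), or at a limit time; in the last case it is a limit position,
whose bits are all `0`, as a blank cell shows.

Everything remembered must survive inferior limits: the state is stored as the bits `j < q`, and
arrival records alternate between two cells so that both vanish at limits.
`otmClockable_of_tapeTraces` turns such a description of histories into a program. -/

open Filter Order

/-! ### Inferior limits along an ordinal. -/

section Liminf

variable {l : Ordinal.{u}}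

theorem nonempty_Iio_of_isSuccLimit (hl : IsSuccLimit l) : Nonempty (Set.Iio l) :=
  ⟨⟨0, hl.bot_lt⟩⟩

theorem eventually_Iio_iff (hl : IsSuccLimit l) {p : Set.Iio l → Prop} :
    (∀ᶠ s in atTop, p s) ↔ ∃ a < l, ∀ s (hs : s < l), a ≤ s → p ⟨s, hs⟩ := by
  have := nonempty_Iio_of_isSuccLimit hl
  rw [eventually_atTop]
  constructor
  · rintro ⟨a, ha⟩
    exact ⟨a.1, a.2, fun s hs h => ha ⟨s, hs⟩ h⟩
  · rintro ⟨a, ha, h⟩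
    exact ⟨⟨a, ha⟩, fun s hs => h s.1 s.2 hs⟩

variable {γ : Type*} [ConditionallyCompleteLinearOrderBot γ]

theorem isCoboundedUnder_Iio (hl : IsSuccLimit l) {u : Set.Iio l → γ}
    (hu : BddAbove (Set.range u)) : IsCoboundedUnder (· ≥ ·) atTop u := by
  have := nonempty_Iio_of_isSuccLimit hl
  exact (BddAbove.isBoundedUnder_of_range hu).isCoboundedUnder_ge

theorem eventually_lt_of_lt_liminf_Iio {u : Set.Iio l → γ} {a : γ}
    (h : a < liminf u atTop) : ∀ᶠ s in atTop, a < u s :=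
  eventually_lt_of_lt_liminf h ⟨⊥, by simp⟩

variable [SuccOrder γ] [NoMaxOrder γ]

/-- Otherwise the values would eventually be at least the successor of the inferior limit.
Boundedness is needed because `γ` is only conditionally complete. -/
theorem frequently_le_liminf_Iio (hl : IsSuccLimit l) {u : Set.Iio l → γ}
    (hu : BddAbove (Set.range u)) : ∃ᶠ s in atTop, u s ≤ liminf u atTop := by
  intro h
  have h2 : succ (liminf u atTop) ≤ liminf u atTop :=
    le_liminf_of_le (isCoboundedUnder_Iio hl hu)
      (h.mono fun s hs => succ_le_of_lt (not_le.1 hs))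
  exact (lt_succ (liminf u atTop)).not_ge h2

theorem liminf_Iio_eq (hl : IsSuccLimit l) {u : Set.Iio l → γ} (hu : BddAbove (Set.range u))
    {L : γ} (h1 : ∀ a < L, ∀ᶠ s in atTop, a < u s) (h2 : ∃ᶠ s in atTop, u s ≤ L) :
    liminf u atTop = L := by
  apply le_antisymm
  · by_contra! h
    exact h2 ((eventually_lt_of_lt_liminf_Iio h).mono fun s hs => not_le.2 hs)
  · by_contra! h
    refine frequently_le_liminf_Iio hl hu ?_
    exact (h1 _ h).mono fun s hs => not_le.2 hs

theorem liminf_Iio_bool_eq {u : Set.Iio l → Bool} {b : Bool}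
    (h : b = true ↔ ∀ᶠ s in atTop, u s = true) : b = liminf u atTop := by
  rw [Bool.eq_iff_iff, h]
  constructor
  · intro h
    have : true ≤ liminf u atTop :=
      le_liminf_of_le (by isBoundedDefault) (h.mono fun s hs => hs ▸ le_rfl)
    exact top_le_iff.1 this
  · intro h
    have : false < liminf u atTop := by rw [h]; decide
    exact (eventually_lt_of_lt_liminf this (by isBoundedDefault)).mono
      fun s hs => by revert hs; cases u s <;> decide

theorem bddAbove_range_Iio (u : Set.Iio l → Ordinal.{u}) : BddAbove (Set.range u) :=
  Ordinal.bddAbove_of_small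

/-- A monotone function that is continuous at limits commutes with inferior limits. -/
theorem map_liminf_Iio (hl : IsSuccLimit l) {f : Ordinal.{u} → Ordinal.{u}} (hf : Monotone f)
    (hc : ∀ x, IsSuccLimit x → ∀ a < f x, ∃ b < x, a < f b) (u : Set.Iio l → Ordinal.{u}) :
    f (liminf u atTop) = liminf (fun s => f (u s)) atTop := by
  have hu := bddAbove_range_Iio u
  refine (liminf_Iio_eq hl (bddAbove_range_Iio _) (fun a ha => ?_)
    ((frequently_le_liminf_Iio hl hu).mono fun s hs => hf hs)).symm
  set x := liminf u atTop with hx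
  rcases Ordinal.zero_or_succ_or_isSuccLimit x with h | ⟨b, h⟩ | h
  · rw [h] at ha
    exact Eventually.of_forall fun s => ha.trans_le (hf zero_le)
  · have : b < x := by rw [← h]; simp
    refine (eventually_lt_of_lt_liminf_Iio this).mono fun s hs => ha.trans_le (hf ?_)
    rw [← h]
    simpa using hs
  · obtain ⟨b, hb, hab⟩ := hc x h a ha
    exact (eventually_lt_of_lt_liminf_Iio hb).mono fun s hs => hab.trans_le (hf hs.le)

end Liminf

namespace HeadMove

@[simp] theorem apply_left_zero : left.apply (0 : Ordinal.{u}) = 0 := by simp [apply]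

@[simp] theorem apply_left_add_one (x : Ordinal.{u}) : left.apply (x + 1) = x := by simp [apply]

theorem apply_left_of_isSuccLimit {x : Ordinal.{u}} (h : IsSuccLimit x) : left.apply x = 0 := by
  simp [apply, Ordinal.limitRecOn_limit _ _ _ _ h]

@[simp] theorem apply_stay (x : Ordinal.{u}) : stay.apply x = x := rfl

@[simp] theorem apply_right (x : Ordinal.{u}) : right.apply x = x + 1 := rfl

end HeadMove

/-! ### From tape histories to a program. -/

/-- The history, up to time `α`, of one tape with its head. -/
structure TapeTrace (α : Ordinal.{u}) where
  head : Ordinal.{u} → Ordinal.{u}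
  tape : Ordinal.{u} → Ordinal.{u} → Bool
  write : Ordinal.{u} → Bool
  move : Ordinal.{u} → HeadMove
  head_zero : head 0 = 0
  tape_zero : ∀ x, tape 0 x = false
  head_succ : ∀ t < α, head (t + 1) = (move t).apply (head t)
  tape_succ : ∀ t < α, tape (t + 1) = Function.update (tape t) (head t) (write t)
  head_limit : ∀ l ≤ α, IsSuccLimit l →
    head l = liminf (fun s : Set.Iio l => head s) atTop
  tape_limit : ∀ l ≤ α, IsSuccLimit l → ∀ x,
    tape l x = liminf (fun s : Set.Iio l => tape s x) atTop

/-- The symbol scanned at time `t`. -/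
def TapeTrace.scan {α : Ordinal.{u}} (T : TapeTrace α) (t : Ordinal.{u}) : Bool :=
  T.tape t (T.head t)

namespace OTMProgram

@[simp] theorem run_zero (P : OTMProgram) : P.run (0 : Ordinal.{u}) = P.init := by
  simp [run]

@[simp] theorem run_add_one (P : OTMProgram) (t : Ordinal.{u}) :
    P.run (t + 1) = P.step (P.run t) := by
  simp [run]

theorem run_limit (P : OTMProgram) {l : Ordinal.{u}} (hl : IsSuccLimit l) :
    P.run l = limitConfig fun s : Set.Iio l => P.run s := by
  rw [run, Ordinal.limitRecOn_limit _ _ _ _ hl]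
  rfl

end OTMProgram

/-- If finitely many tape traces evolve by actions that depend only on the symbols scanned
simultaneously, and those symbols also determine an event that occurs at time `α` for the first
time, then `α` is clockable. -/
theorem otmClockable_of_tapeTraces {α : Ordinal.{u}} {ι : Type} [Finite ι] [Nonempty ι]
    (T : ι → TapeTrace α) (fire : Ordinal.{u} → Prop)
    (hdet : ∀ t ≤ α, ∀ t' ≤ α, (∀ i, (T i).scan t = (T i).scan t') →
      (∀ i, (T i).write t = (T i).write t' ∧ (T i).move t = (T i).move t') ∧
        (fire t → fire t'))
    (hfire : fire α) (hnot : ∀ t < α, ¬ fire t) : OTMClockable α := by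
  classical
  obtain ⟨k, ⟨e⟩⟩ := Finite.exists_equiv_fin ι
  have hk : 0 < k := by
    obtain ⟨i⟩ := ‹Nonempty ι›
    exact (Nat.zero_le _).trans_lt (e i).2
  -- A pattern of symbols is answered as at some time when it occurs; the default `0` serves
  -- patterns that do not occur up to `α`.
  let rep : (Fin k → Bool) → Ordinal.{u} := fun s =>
    if h : ∃ t ≤ α, ∀ i, (T (e.symm i)).scan t = s i then h.choose else 0
  let P : OTMProgram :=
    { numTapes := k
      numTapes_pos := hk
      -- A single working state: all memory is on the tapes, so the state at limits is trivially
      -- right.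
      numStates := 1
      command := fun _ s =>
        { write := fun i => (T (e.symm i)).write (rep s)
          move := fun i => (T (e.symm i)).move (rep s)
          nextState := if fire (rep s) then 1 else 0 } }
  have hrep : ∀ t ≤ α, (∀ i, (T i).write (rep fun j => (T (e.symm j)).scan t) = (T i).write t ∧
      (T i).move (rep fun j => (T (e.symm j)).scan t) = (T i).move t) ∧
      (fire (rep fun j => (T (e.symm j)).scan t) ↔ fire t) := by
    intro t ht
    have hex : ∃ t' ≤ α, ∀ i, (T (e.symm i)).scan t' = (T (e.symm i)).scan t :=
      ⟨t, ht, fun _ => rfl⟩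
    have hr : (rep fun j => (T (e.symm j)).scan t) = hex.choose := dif_pos hex
    rw [hr]
    obtain ⟨h1, h2⟩ := hex.choose_spec
    have h3 : ∀ i, (T i).scan hex.choose = (T i).scan t := fun i => by
      simpa using h2 (e i)
    exact ⟨(hdet _ h1 t ht h3).1, (hdet _ h1 t ht h3).2,
      (hdet t ht _ h1 fun i => (h3 i).symm).2⟩
  have hstep : ∀ t ≤ α, P.run t = ⟨0, fun i => (T (e.symm i)).head t,
      fun i => (T (e.symm i)).tape t⟩ →
      P.run (t + 1) = ⟨if fire t then 1 else 0,
        fun i => ((T (e.symm i)).move t).apply ((T (e.symm i)).head t),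
        fun i => Function.update ((T (e.symm i)).tape t) ((T (e.symm i)).head t)
          ((T (e.symm i)).write t)⟩ := by
    intro t ht h
    obtain ⟨h1, h2⟩ := hrep t ht
    rw [OTMProgram.run_add_one, h, OTMProgram.step]
    rw [dif_pos (show (0 : ℕ) < P.numStates from Nat.one_pos)]
    have e1 : ∀ i, (T (e.symm i)).write (rep fun j => (T (e.symm j)).scan t) = _ :=
      fun i => (h1 (e.symm i)).1
    have e2 : ∀ i, (T (e.symm i)).move (rep fun j => (T (e.symm j)).scan t) = _ :=
      fun i => (h1 (e.symm i)).2
    ext1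
    · exact if_congr h2 rfl rfl
    · funext i
      exact congrArg (fun m => HeadMove.apply m _) (e2 i)
    · funext i
      exact congrArg (fun m => Function.update _ _ m) (e1 i)
  have hrun : ∀ t ≤ α, P.run t = ⟨0, fun i => (T (e.symm i)).head t,
      fun i => (T (e.symm i)).tape t⟩ := by
    intro t
    induction t using Ordinal.limitRecOn with
    | zero =>
      intro _
      rw [OTMProgram.run_zero]
      ext1
      · rfl
      · funext i; exact ((T (e.symm i)).head_zero).symm
      · funext i x; exact ((T (e.symm i)).tape_zero x).symm
    | add_one t ih =>
      intro ht
      have htα : t < α := (lt_add_one t).trans_le ht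
      rw [hstep t htα.le (ih htα.le)]
      ext1
      · simp [hnot t htα]
      · funext i; exact ((T (e.symm i)).head_succ t htα).symm
      · funext i; exact ((T (e.symm i)).tape_succ t htα).symm
    | limit l hl ih =>
      intro ht
      have := nonempty_Iio_of_isSuccLimit hl
      rw [OTMProgram.run_limit _ hl]
      have : (fun s : Set.Iio l => P.run s.1) = fun s : Set.Iio l =>
          (⟨0, fun i => (T (e.symm i)).head s, fun i => (T (e.symm i)).tape s⟩ :
            OTMConfig P.numTapes) :=
        funext fun s => ih s.1 s.2 (s.2.le.trans ht)
      rw [this]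
      ext1
      · exact liminf_const 0
      · funext i; exact ((T (e.symm i)).head_limit l ht hl).symm
      · funext i x; exact ((T (e.symm i)).tape_limit l ht hl x).symm
  refine ⟨P, ?_, fun s hs => ?_⟩
  · rw [hstep α le_rfl (hrun α le_rfl)]
    simp [hfire, P]
  · rw [hrun s (by simpa using hs)]
    exact Nat.one_pos

/-! ### Splitting a tape into three residue classes. -/

section Residues

/-- The residue of an ordinal modulo `3`. -/
noncomputable def residue (p : Ordinal.{u}) : Fin 3 :=
  open Classical in if p % 3 = 1 then 1 else if p % 3 = 2 then 2 else 0

/-- In the decomposition of the ordinals into three residue classes, the largest index in class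
`k` of a position that is at most `p + 1`. -/
noncomputable def window (k : Fin 3) (p : Ordinal.{u}) : Ordinal.{u} :=
  match k with
  | 0 => (p + 1) / 3
  | 1 => p / 3
  | 2 => Ordinal.pred p / 3

theorem not_exists_eq_add_one_of_isSuccLimit {p : Ordinal.{u}} (h : IsSuccLimit p) :
    ¬ ∃ q, p = q + 1 := by
  rintro ⟨q, rfl⟩
  exact not_isSuccLimit_add_one _ h

theorem not_exists_zero_eq_add_one : ¬ ∃ q : Ordinal.{u}, 0 = q + 1 := by
  rintro ⟨q, hq⟩
  exact (lt_add_one q).not_ge (hq ▸ zero_le)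

theorem exists_eq_three_mul (p : Ordinal.{u}) :
    ∃ x, p = 3 * x ∨ p = 3 * x + 1 ∨ p = 3 * x + 1 + 1 := by
  refine ⟨p / 3, ?_⟩
  have h := Ordinal.div_add_mod p 3
  have h3 := Ordinal.mod_lt p (b := 3) (by simp)
  obtain ⟨n, hn⟩ := Ordinal.lt_omega0.1 (h3.trans (Ordinal.natCast_lt_omega0 3))
  rw [hn] at h h3
  have : n < 3 := by exact_mod_cast h3
  interval_cases n
  · left; simpa using h.symm
  · right; left; simpa using h.symm
  · right; right; rw [add_assoc, one_add_one_eq_two]; simpa using h.symm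

theorem one_lt_three_ordinal : (1 : Ordinal.{u}) < 3 := by exact_mod_cast (by norm_num : 1 < 3)
theorem two_lt_three_ordinal : (2 : Ordinal.{u}) < 3 := by exact_mod_cast (by norm_num : 2 < 3)
theorem one_ne_two_ordinal : (1 : Ordinal.{u}) ≠ 2 := by exact_mod_cast (by norm_num : 1 ≠ 2)

theorem three_mul_add_three (x : Ordinal.{u}) : 3 * x + 1 + 1 + 1 = 3 * (x + 1) := by
  rw [mul_add_one, add_assoc, add_assoc]
  congr 1
  exact_mod_cast (by norm_num : 1 + (1 + 1) = 3)

theorem three_mul_div (x : Ordinal.{u}) : 3 * x / 3 = x := Ordinal.mul_div_cancel x (by simp)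

theorem three_mul_add_one_div (x : Ordinal.{u}) : (3 * x + 1) / 3 = x := by
  rw [Ordinal.mul_add_div _ (by simp), Ordinal.div_eq_zero_of_lt one_lt_three_ordinal, add_zero]

theorem three_mul_add_two_div (x : Ordinal.{u}) : (3 * x + 1 + 1) / 3 = x := by
  rw [add_assoc, one_add_one_eq_two, Ordinal.mul_add_div _ (by simp),
    Ordinal.div_eq_zero_of_lt two_lt_three_ordinal, add_zero]

theorem residue_three_mul (x : Ordinal.{u}) : residue (3 * x) = 0 := by
  simp [residue, Ordinal.mul_mod]

theorem residue_three_mul_add_one (x : Ordinal.{u}) : residue (3 * x + 1) = 1 := by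
  simp [residue, Ordinal.mul_add_mod_self, Ordinal.mod_eq_of_lt one_lt_three_ordinal]

theorem residue_three_mul_add_two (x : Ordinal.{u}) : residue (3 * x + 1 + 1) = 2 := by
  rw [add_assoc, one_add_one_eq_two]
  simp [residue, Ordinal.mul_add_mod_self, Ordinal.mod_eq_of_lt two_lt_three_ordinal,
    one_ne_two_ordinal.symm]

theorem residue_add_one (p : Ordinal.{u}) : residue (p + 1) = residue p + 1 := by
  obtain ⟨x, rfl | rfl | rfl⟩ := exists_eq_three_mul p
  · rw [residue_three_mul, residue_three_mul_add_one]; rfl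
  · rw [residue_three_mul_add_one, residue_three_mul_add_two]; rfl
  · rw [three_mul_add_three, residue_three_mul, residue_three_mul_add_two]; rfl

theorem residue_eq_zero_of_isSuccLimit {p : Ordinal.{u}} (h : IsSuccLimit p) : residue p = 0 := by
  obtain ⟨x, rfl | rfl | rfl⟩ := exists_eq_three_mul p
  · exact residue_three_mul x
  · exact absurd h (not_isSuccLimit_add_one _)
  · exact absurd h (not_isSuccLimit_add_one _)

theorem pred_three_mul_div (x : Ordinal.{u}) : Ordinal.pred (3 * x) / 3 = Ordinal.pred x := by
  rcases Ordinal.zero_or_succ_or_isSuccLimit x with rfl | ⟨y, rfl⟩ | h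
  · simp
  · have := three_mul_add_three y
    simp only [succ_eq_add_one]
    rw [← this, Ordinal.pred_add_one, three_mul_add_two_div, Ordinal.pred_add_one]
  · have h3 : IsSuccLimit (3 * x) := Ordinal.isSuccLimit_mul_right (by simp) h
    rw [h3.ordinalPred_eq, h.ordinalPred_eq, three_mul_div]

theorem three_mul_eq_add_one_iff (x : Ordinal.{u}) :
    (∃ q, 3 * x = q + 1) ↔ ∃ y, x = y + 1 := by
  rcases Ordinal.zero_or_succ_or_isSuccLimit x with rfl | ⟨y, rfl⟩ | h
  · simp
  · exact ⟨fun _ => ⟨y, rfl⟩, fun _ => ⟨_, (three_mul_add_three y).symm⟩⟩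
  · have h3 : IsSuccLimit (3 * x) := Ordinal.isSuccLimit_mul_right (by simp) h
    constructor
    · rintro ⟨q, hq⟩
      exact absurd (hq ▸ h3) (not_isSuccLimit_add_one _)
    · rintro ⟨q, hq⟩
      exact absurd (hq ▸ h) (not_isSuccLimit_add_one _)

theorem window_monotone (k : Fin 3) : Monotone (window.{u} k) := by
  intro p q h
  fin_cases k
  · exact Ordinal.div_le_left (by gcongr) 3
  · exact Ordinal.div_le_left h 3
  · exact Ordinal.div_le_left (Ordinal.pred_succ_gi.gc.monotone_l h) 3

theorem window_zero (k : Fin 3) : window k (0 : Ordinal.{u}) = 0 := by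
  fin_cases k
  · simpa [window] using three_mul_add_one_div (0 : Ordinal.{u})
  · simp [window]
  · simp [window]

theorem window_of_isSuccLimit (k : Fin 3) {p : Ordinal.{u}} (h : IsSuccLimit p) :
    window k p = p / 3 := by
  fin_cases k
  · obtain ⟨x, rfl | rfl | rfl⟩ := exists_eq_three_mul p
    · simp [window, three_mul_add_one_div]
    · exact absurd h (not_isSuccLimit_add_one _)
    · exact absurd h (not_isSuccLimit_add_one _)
  · rfl
  · simp [window, h.ordinalPred_eq]

theorem window_continuous (k : Fin 3) (x : Ordinal.{u}) (hx : IsSuccLimit x) (a : Ordinal.{u})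
    (ha : a < window k x) : ∃ b < x, a < window k b := by
  rw [window_of_isSuccLimit k hx, Ordinal.lt_div (by simp)] at ha
  simp only [succ_eq_add_one] at ha
  have hlt : 3 * (a + 1) < x := by
    refine lt_of_le_of_ne ha fun h => ?_
    rw [← h, ← three_mul_add_three] at hx
    exact not_isSuccLimit_add_one _ hx
  -- All three windows have the value `a + 1` here; at `3 * (a + 1)` the window of class 2 is still
  -- `a`.
  refine ⟨3 * (a + 1) + 1, hx.add_one_lt hlt, ?_⟩
  have h1 : a < a + 1 := lt_add_one a
  fin_cases k
  · exact h1.trans_eq (three_mul_add_two_div (a + 1)).symm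
  · simp [window, three_mul_add_one_div]
  · simp [window, Ordinal.pred_add_one]

-- At a successor `p` the windows cover `p - 1`, `p`, `p + 1`; at `0` or a limit they cover `p`, `p
-- + 1`, `p + 2`. Hence a step to the right moves only the head of the class of `p - 1`, and no head
-- if `p` is not a successor.
open Classical in
theorem window_add_one (k : Fin 3) (p : Ordinal.{u}) :
    window k (p + 1) =
      if (∃ q, p = q + 1) ∧ residue p = k + 1 then window k p + 1 else window k p := by
  obtain ⟨x, rfl | rfl | rfl⟩ := exists_eq_three_mul p
  · rw [residue_three_mul, three_mul_eq_add_one_iff]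
    rcases Ordinal.zero_or_succ_or_isSuccLimit x with rfl | ⟨y, rfl⟩ | h
    · have h1 := three_mul_add_one_div (0 : Ordinal.{u})
      have h2 := three_mul_add_two_div (0 : Ordinal.{u})
      rw [mul_zero] at h1 h2
      have hn : ¬ ∃ y, (0 : Ordinal.{u}) = y + 1 := not_exists_zero_eq_add_one
      rw [if_neg fun h => hn h.1]
      rw [zero_add] at h1 h2
      have h3 : Ordinal.pred (1 : Ordinal.{u}) = 0 := by simpa using Ordinal.pred_add_one 0
      fin_cases k <;> simp [window, h1, h2, h3]
    · fin_cases k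
      · simp [window, three_mul_add_two_div, three_mul_add_one_div]
      · simp [window, three_mul_add_one_div]
      · simp [window, pred_three_mul_div, Ordinal.pred_add_one]
    · have hn := not_exists_eq_add_one_of_isSuccLimit h
      rw [if_neg (fun h => hn h.1)]
      fin_cases k
      · simp [window, three_mul_add_two_div, three_mul_add_one_div]
      · simp [window, three_mul_add_one_div]
      · simp [window, pred_three_mul_div, h.ordinalPred_eq]
  · rw [residue_three_mul_add_one]
    fin_cases k
    · simp [window, three_mul_add_three, three_mul_add_two_div]
    · simp [window, three_mul_add_one_div, three_mul_add_two_div]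
    · simp [window, three_mul_add_one_div]
  · rw [residue_three_mul_add_two]
    have := three_mul_add_one_div (x + 1)
    fin_cases k
    · simp [window, three_mul_add_three, this]
    · simp [window, three_mul_add_three, three_mul_add_two_div]
    · simp [window, three_mul_add_two_div, three_mul_add_one_div]

/-- The position with index `x` in the residue class `k`. -/
noncomputable def positionOf (k : Fin 3) (x : Ordinal.{u}) : Ordinal.{u} :=
  match k with
  | 0 => 3 * x
  | 1 => 3 * x + 1
  | 2 => 3 * x + 1 + 1

theorem residue_positionOf (k : Fin 3) (x : Ordinal.{u}) : residue (positionOf k x) = k := by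
  fin_cases k
  · exact residue_three_mul x
  · exact residue_three_mul_add_one x
  · exact residue_three_mul_add_two x

theorem window_positionOf (k : Fin 3) (x : Ordinal.{u}) : window k (positionOf k x) = x := by
  fin_cases k
  · exact three_mul_add_one_div x
  · exact three_mul_add_one_div x
  · change Ordinal.pred (3 * x + 1 + 1) / 3 = x
    rw [Ordinal.pred_add_one, three_mul_add_one_div]

theorem exists_eq_positionOf (p : Ordinal.{u}) : ∃ x, p = positionOf (residue p) x := by
  obtain ⟨x, rfl | rfl | rfl⟩ := exists_eq_three_mul p <;> refine ⟨x, ?_⟩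
  · rw [residue_three_mul]; rfl
  · rw [residue_three_mul_add_one]; rfl
  · rw [residue_three_mul_add_two]; rfl

theorem positionOf_window_residue (p : Ordinal.{u}) :
    positionOf (residue p) (window (residue p) p) = p := by
  obtain ⟨x, hx⟩ := exists_eq_positionOf p
  have h := window_positionOf (residue p) x
  rw [← hx] at h
  rw [h, ← hx]

theorem window_residue_add_one (p : Ordinal.{u}) :
    window (residue p) (p + 1) = window (residue p) p := by
  rw [window_add_one, if_neg]
  rintro ⟨-, h⟩
  revert h
  generalize residue p = r
  revert r; decide

theorem positionOf_window_residue_pred (p : Ordinal.{u}) :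
    positionOf (residue p) (window (residue p) (p + 1)) = p := by
  rw [window_residue_add_one, positionOf_window_residue]

theorem positionOf_window_residue_succ (p : Ordinal.{u}) :
    positionOf (residue (p + 1)) (window (residue (p + 1)) p) = p + 1 := by
  have h := window_add_one (residue (p + 1)) p
  rw [if_neg] at h
  · rw [← h, positionOf_window_residue]
  · rintro ⟨-, h⟩
    rw [residue_add_one] at h
    revert h
    generalize residue p = r
    revert r; decide

open Classical in
/-- The move of the head at `window k p` when a head at `p` makes the move `m`. -/
noncomputable def windowMove (k : Fin 3) (m : HeadMove) (p : Ordinal.{u}) : HeadMove :=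
  match m with
  | .stay => .stay
  | .right => if (∃ q, p = q + 1) ∧ residue p = k + 1 then .right else .stay
  | .left =>
    if ∃ q, p = q + 1 then
      if (∃ q, p = q + 1 + 1) ∧ residue p = k + 2 then .left else .stay
    else .left

theorem windowMove_apply (k : Fin 3) (m : HeadMove) (p : Ordinal.{u}) :
    (windowMove k m p).apply (window k p) = window k (m.apply p) := by
  cases m with
  | stay => rfl
  | right =>
    rw [HeadMove.apply_right, window_add_one, windowMove]
    split_ifs <;> rfl
  | left =>
    rcases Ordinal.zero_or_succ_or_isSuccLimit p with rfl | ⟨q, rfl⟩ | h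
    · rw [windowMove, if_neg not_exists_zero_eq_add_one]
      rw [window_zero, HeadMove.apply_left_zero, window_zero]
    · simp only [succ_eq_add_one]
      rw [HeadMove.apply_left_add_one, window_add_one, windowMove, if_pos ⟨q, rfl⟩]
      have h1 : residue (q + 1) = k + 2 ↔ residue q = k + 1 := by
        rw [residue_add_one]
        generalize residue q = r
        revert r k; decide
      have h2 : (∃ r, q + 1 = r + 1 + 1) ↔ ∃ r, q = r + 1 := by simp
      by_cases hc : (∃ r, q = r + 1) ∧ residue q = k + 1
      · rw [if_pos hc, if_pos ⟨h2.2 hc.1, h1.2 hc.2⟩, HeadMove.apply_left_add_one]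
      · rw [if_neg hc, if_neg fun h => hc ⟨h2.1 h.1, h1.1 h.2⟩, HeadMove.apply_stay]
    · have hn := not_exists_eq_add_one_of_isSuccLimit h
      rw [windowMove, if_neg hn, HeadMove.apply_left_of_isSuccLimit h, window_zero,
        window_of_isSuccLimit k h]
      -- The quotient of a limit by 3 is again a limit, so a left move sends the window head to `0`
      -- as well.
      obtain ⟨x, hx | hx | hx⟩ := exists_eq_three_mul p
      · rw [hx, three_mul_div]
        rcases Ordinal.zero_or_succ_or_isSuccLimit x with rfl | ⟨y, rfl⟩ | h'
        · simp
        · exact absurd ⟨_, hx.trans (three_mul_add_three y).symm⟩ hn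
        · exact HeadMove.apply_left_of_isSuccLimit h'
      · exact absurd ⟨_, hx⟩ hn
      · exact absurd ⟨_, hx⟩ hn

end Residues

/-! ### Parity of times. -/

section Parity

/-- Whether the finite part of a time is odd. -/
noncomputable def timeParity (t : Ordinal.{u}) : Bool :=
  open Classical in decide (t % 2 = 1)

theorem timeParity_zero : timeParity (0 : Ordinal.{u}) = false := by
  simp [timeParity, Ordinal.zero_mod]

theorem timeParity_add_one (t : Ordinal.{u}) : timeParity (t + 1) = !timeParity t := by
  have h := Ordinal.div_add_mod t 2
  have h3 := Ordinal.mod_lt t (b := 2) (by simp)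
  have h12 : (1 : Ordinal.{u}) < 2 := by exact_mod_cast (by norm_num : 1 < 2)
  obtain ⟨n, hn⟩ := Ordinal.lt_omega0.1 (h3.trans (Ordinal.natCast_lt_omega0 2))
  rw [hn] at h h3
  have : n < 2 := by exact_mod_cast h3
  rw [timeParity, timeParity, hn, ← h]
  interval_cases n
  · simp [Ordinal.mul_add_mod_self, Ordinal.mod_eq_of_lt h12]
  · rw [add_assoc, Nat.cast_one, one_add_one_eq_two, ← mul_add_one, Ordinal.mul_mod]
    simp

theorem timeParity_of_isSuccLimit {l : Ordinal.{u}} (hl : IsSuccLimit l) :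
    timeParity l = false := by
  rcases h : timeParity l with _ | _
  · rfl
  · have h1 := Ordinal.div_add_mod l 2
    rw [of_decide_eq_true h] at h1
    exact absurd (h1 ▸ hl) (not_isSuccLimit_add_one _)

/-- This makes the parity bit and the arrival records vanish at limit times. -/
theorem not_eventually_of_alternating {l : Ordinal.{u}} (hl : IsSuccLimit l)
    {p : Ordinal.{u} → Prop} (hp : ∀ t, p t → ¬ p (t + 1)) :
    ¬ ∀ᶠ s : Set.Iio l in atTop, p s := by
  rw [eventually_Iio_iff hl]
  rintro ⟨a, ha, h⟩
  exact hp a (h a ha le_rfl) (h _ (hl.add_one_lt ha) (le_add_of_nonneg_right zero_le))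

end Parity

/-! ### Finite information about positions. -/

section PositionInfo

open Classical in
/-- Five bits of information about the location of an ordinal. -/
noncomputable def positionInfo (j : Fin 5) (p : Ordinal.{u}) : Bool :=
  match j with
  | 0 => decide (residue p = 1)
  | 1 => decide (residue p = 2)
  | 2 => decide (∃ q, p = q + 1)
  | 3 => decide (p = 0)
  | 4 => decide (∃ q, p = q + 1 + 1)

/-- The bits are chosen so that a blank cell at a limit position already shows the right
information. -/
theorem positionInfo_of_isSuccLimit (j : Fin 5) {p : Ordinal.{u}} (h : IsSuccLimit p) :
    positionInfo j p = false := by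
  have h1 := residue_eq_zero_of_isSuccLimit h
  have h2 := not_exists_eq_add_one_of_isSuccLimit h
  fin_cases j
  · simp [positionInfo, h1]
  · simp [positionInfo, h1]
  · simpa [positionInfo] using fun q hq => h2 ⟨q, hq⟩
  · exact decide_eq_false h.bot_lt.ne'
  · simpa [positionInfo] using fun q hq => h2 ⟨_, hq⟩

variable {p p' : Ordinal.{u}}

theorem residue_congr (h : ∀ j, positionInfo j p = positionInfo j p') :
    residue p = residue p' := by
  have h0 := decide_eq_decide.1 (h 0)
  have h1 := decide_eq_decide.1 (h 1)
  revert h0 h1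
  generalize residue p = r
  generalize residue p' = r'
  revert r r'; decide

theorem isSucc_congr (h : ∀ j, positionInfo j p = positionInfo j p') :
    (∃ q, p = q + 1) ↔ ∃ q, p' = q + 1 := decide_eq_decide.1 (h 2)

theorem eq_zero_congr (h : ∀ j, positionInfo j p = positionInfo j p') :
    p = 0 ↔ p' = 0 := decide_eq_decide.1 (h 3)

theorem isSuccSucc_congr (h : ∀ j, positionInfo j p = positionInfo j p') :
    (∃ q, p = q + 1 + 1) ↔ ∃ q, p' = q + 1 + 1 := decide_eq_decide.1 (h 4)

/-- Because of this, the bits of a cell can be recorded while the head is still on its left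
neighbour. -/
theorem positionInfo_add_one_congr (h : ∀ j, positionInfo j p = positionInfo j p') (j : Fin 5) :
    positionInfo j (p + 1) = positionInfo j (p' + 1) := by
  fin_cases j
  · simp only [positionInfo, residue_add_one, residue_congr h]
  · simp only [positionInfo, residue_add_one, residue_congr h]
  · simp [positionInfo]
  · simp [positionInfo]
  · simpa [positionInfo] using isSucc_congr h

theorem windowMove_congr (h : ∀ j, positionInfo j p = positionInfo j p') (k : Fin 3)
    (m : HeadMove) : windowMove k m p = windowMove k m p' := by
  cases m
  · classical
    refine if_congr (isSucc_congr h) (if_congr (and_congr (isSuccSucc_congr h) ?_) rfl rfl) rfl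
    rw [residue_congr h]
  · rfl
  · classical
    refine if_congr (and_congr (isSucc_congr h) ?_) rfl rfl
    rw [residue_congr h]

end PositionInfo

/-! ### Evolution of a computation and of its heads. -/

theorem HeadMove.apply_left_le (p : Ordinal.{u}) : left.apply p ≤ p := by
  rcases Ordinal.zero_or_succ_or_isSuccLimit p with rfl | ⟨q, rfl⟩ | h
  · simp
  · simp
  · rw [apply_left_of_isSuccLimit h]; exact zero_le

theorem HeadMove.apply_eq_add_one_iff (m : HeadMove) (p : Ordinal.{u}) :
    m.apply p = p + 1 ↔ m = right := by
  cases m with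
  | left => simp [((apply_left_le p).trans_lt (lt_add_one p)).ne]
  | stay => simp
  | right => simp

namespace OTMProgram

variable (P : OTMProgram)

/-- The command executed in state `q` when the symbols `s` are scanned; in a halting state, a
command that changes nothing. -/
def action (q : ℕ) (s : Fin P.numTapes → Bool) : OTMCommand P.numTapes :=
  if h : q < P.numStates then P.command ⟨q, h⟩ s else ⟨s, fun _ => .stay, q⟩

/-- The symbols scanned at time `t`. -/
noncomputable def scanned (t : Ordinal.{u}) (i : Fin P.numTapes) : Bool :=
  (P.run t).tape i ((P.run t).head i)

/-- The command executed at time `t`. -/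
noncomputable def actionAt (t : Ordinal.{u}) : OTMCommand P.numTapes :=
  P.action (P.run t).state (P.scanned t)

theorem run_add_one_eq (t : Ordinal.{u}) :
    P.run (t + 1) = ⟨(P.actionAt t).nextState,
      fun i => ((P.actionAt t).move i).apply ((P.run t).head i),
      fun i => Function.update ((P.run t).tape i) ((P.run t).head i) ((P.actionAt t).write i)⟩ := by
  rw [run_add_one, step]
  by_cases h : (P.run t).state < P.numStates
  · simp only [dif_pos h, actionAt, action]
    rfl
  · simp only [dif_neg h, actionAt, action]
    ext1
    · rfl
    · rfl
    · funext i
      exact (Function.update_eq_self _ _).symm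

theorem state_add_one (t : Ordinal.{u}) :
    (P.run (t + 1)).state = (P.actionAt t).nextState := by rw [run_add_one_eq]

theorem head_add_one (t : Ordinal.{u}) (i : Fin P.numTapes) :
    (P.run (t + 1)).head i = ((P.actionAt t).move i).apply ((P.run t).head i) := by
  rw [run_add_one_eq]

theorem tape_add_one (t : Ordinal.{u}) (i : Fin P.numTapes) :
    (P.run (t + 1)).tape i =
      Function.update ((P.run t).tape i) ((P.run t).head i) ((P.actionAt t).write i) := by
  rw [run_add_one_eq]

theorem head_zero (i : Fin P.numTapes) : (P.run (0 : Ordinal.{u})).head i = 0 := by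
  rw [run_zero]; rfl

theorem tape_zero (i : Fin P.numTapes) (x : Ordinal.{u}) : (P.run 0).tape i x = false := by
  rw [run_zero]; rfl

variable {P} {l : Ordinal.{u}}

theorem head_limit (hl : IsSuccLimit l) (i : Fin P.numTapes) :
    (P.run l).head i = liminf (fun s : Set.Iio l => (P.run s).head i) atTop := by
  rw [run_limit _ hl]; rfl

theorem tape_limit (hl : IsSuccLimit l) (i : Fin P.numTapes) (x : Ordinal.{u}) :
    (P.run l).tape i x = liminf (fun s : Set.Iio l => (P.run s).tape i x) atTop := by
  rw [run_limit _ hl]; rfl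

theorem state_limit (hl : IsSuccLimit l) :
    (P.run l).state = liminf (fun s : Set.Iio l => (P.run s).state) atTop := by
  rw [run_limit _ hl]; rfl

theorem tape_limit_eq_true_iff (hl : IsSuccLimit l) (i : Fin P.numTapes) (x : Ordinal.{u}) :
    (P.run l).tape i x = true ↔ ∀ᶠ s : Set.Iio l in atTop, (P.run s).tape i x = true := by
  rw [tape_limit hl]
  constructor
  · intro h
    have : false < liminf (fun s : Set.Iio l => (P.run s).tape i x) atTop := by rw [h]; decide
    exact (eventually_lt_of_lt_liminf this (by isBoundedDefault)).mono
      fun s hs => by revert hs; cases (P.run s).tape i x <;> decide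
  · intro h
    exact (liminf_Iio_bool_eq (b := true) (by simpa using h)).symm

/-- Threshold bits commute with inferior limits, which is why the state is stored in unary; binary
digits would not. -/
theorem lt_state_limit_iff (hl : IsSuccLimit l) {N : ℕ} (hN : ∀ s < l, (P.run s).state < N)
    (j : ℕ) : j < (P.run l).state ↔ ∀ᶠ s : Set.Iio l in atTop, j < (P.run s).state := by
  rw [state_limit hl]
  refine ⟨eventually_lt_of_lt_liminf_Iio, fun h => ?_⟩
  by_contra! h'
  refine frequently_le_liminf_Iio hl (u := fun s : Set.Iio l => (P.run s).state) ?_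
    (h.mono fun s hs => not_le.2 (h'.trans_lt hs))
  exact ⟨N, by rintro _ ⟨s, rfl⟩; exact (hN s s.2).le⟩

/-- The positions are eventually above `x` and frequently at most `x + 1`. So a successor position
is never new at a limit time. -/
theorem exists_head_eq_of_head_limit_eq_add_one (hl : IsSuccLimit l) (i : Fin P.numTapes) {x : Ordinal.{u}}
    (hx : (P.run l).head i = x + 1) : ∃ s < l, (P.run s).head i = x + 1 := by
  rw [head_limit hl] at hx
  have h1 := frequently_le_liminf_Iio hl (bddAbove_range_Iio fun s : Set.Iio l => (P.run s).head i)
  have h2 := eventually_lt_of_lt_liminf_Iio (u := fun s : Set.Iio l => (P.run s).head i)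
    (a := x) (by rw [hx]; exact lt_add_one x)
  obtain ⟨s, hs1, hs2⟩ := (h1.and_eventually h2).exists
  exact ⟨s, s.2, le_antisymm (hx ▸ hs1) (by simpa using hs2)⟩

/-- A head reaches a successor position only after its predecessor. -/
theorem exists_head_eq_of_head_eq_add_one (i : Fin P.numTapes) (t : Ordinal.{u}) :
    ∀ x, (P.run t).head i = x + 1 → ∃ s < t, (P.run s).head i = x := by
  induction t using WellFoundedLT.induction with | ind t ih => ?_
  rcases Ordinal.zero_or_succ_or_isSuccLimit t with rfl | ⟨t, rfl⟩ | hl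
  · intro x hx
    rw [head_zero] at hx
    exact absurd ⟨x, hx⟩ not_exists_zero_eq_add_one
  · simp only [succ_eq_add_one] at *
    have hlt := lt_add_one t
    intro x hx
    rw [head_add_one] at hx
    rcases hm : (P.actionAt t).move i with _ | _ | _ <;> rw [hm] at hx
    · rcases Ordinal.zero_or_succ_or_isSuccLimit ((P.run t).head i) with h | ⟨q, h⟩ | h
      · rw [h, HeadMove.apply_left_zero] at hx
        exact absurd ⟨x, hx⟩ not_exists_zero_eq_add_one
      · rw [← h, succ_eq_add_one, HeadMove.apply_left_add_one] at hx
        subst hx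
        -- Before the left move the head was on `x + 2`; going back twice leads through `x + 1` to
        -- `x`.
        obtain ⟨s, hs, h'⟩ := ih t hlt _ h.symm
        obtain ⟨r, hr, h''⟩ := ih s (hs.trans hlt) _ h'
        exact ⟨r, (hr.trans hs).trans hlt, h''⟩
      · rw [HeadMove.apply_left_of_isSuccLimit h] at hx
        exact absurd ⟨x, hx⟩ not_exists_zero_eq_add_one
    · obtain ⟨s, hs, h⟩ := ih t hlt x hx
      exact ⟨s, hs.trans hlt, h⟩
    · rw [HeadMove.apply_right] at hx
      exact ⟨t, hlt, by simpa using hx⟩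
  · intro x hx
    obtain ⟨s, hs, h⟩ := exists_head_eq_of_head_limit_eq_add_one hl i hx
    obtain ⟨r, hr, h'⟩ := ih s hs x h
    exact ⟨r, hr.trans hs, h'⟩

end OTMProgram

/-! ### The tapes of the simulation. -/

namespace TapeTrace

variable {α : Ordinal.{u}}

/-- A bit that is remembered in the first cell of a tape whose head never moves. -/
noncomputable def flag (b : Ordinal.{u} → Bool) (h0 : b 0 = false)
    (hb : ∀ l ≤ α, IsSuccLimit l → (b l = true ↔ ∀ᶠ s : Set.Iio l in atTop, b s = true)) :
    TapeTrace α where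
  head _ := 0
  tape t x := Function.update (fun _ => false) 0 (b t) x
  -- The bit for time `t + 1` is written at time `t`, so it must be computable one step ahead.
  write t := b (t + 1)
  move _ := .stay
  head_zero := rfl
  tape_zero x := by rw [h0]; exact congrFun (Function.update_eq_self _ _) x
  head_succ _ _ := rfl
  tape_succ t _ := (Function.update_idem _ _ _).symm
  head_limit l _ hl := by
    have := nonempty_Iio_of_isSuccLimit hl
    exact (liminf_const 0).symm
  tape_limit l hlα hl x := by
    apply liminf_Iio_bool_eq
    rcases eq_or_ne x 0 with rfl | hx
    · simpa using hb l hlα hl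
    · have := nonempty_Iio_of_isSuccLimit hl
      simp only [Function.update_of_ne hx]
      exact iff_of_false Bool.false_ne_true fun h => h.exists.elim fun _ => Bool.false_ne_true

theorem scan_flag (b : Ordinal.{u} → Bool) (h0 : b 0 = false)
    (hb : ∀ l ≤ α, IsSuccLimit l → (b l = true ↔ ∀ᶠ s : Set.Iio l in atTop, b s = true))
    (t : Ordinal.{u}) : (flag b h0 hb).scan t = b t := by
  simp [scan, flag]

variable (α) (P : OTMProgram) (i : Fin P.numTapes)

open Classical in
/-- A tape with the head of tape `i` on which the positions with the property `f` are marked as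
soon as they are visited. -/
noncomputable def mark (f : Ordinal.{u} → Bool) : TapeTrace α where
  head t := (P.run t).head i
  tape t x := decide (f x = true ∧ ∃ s < t, (P.run s).head i = x)
  write t := f ((P.run t).head i)
  move t := (P.actionAt t).move i
  head_zero := P.head_zero i
  tape_zero x := by simp
  head_succ t _ := P.head_add_one t i
  tape_succ t _ := by
    funext x
    rcases eq_or_ne x ((P.run t).head i) with rfl | hx
    · rw [Function.update_self, Bool.eq_iff_iff, decide_eq_true_iff]
      exact ⟨fun h => h.1, fun h => ⟨h, t, lt_add_one t, rfl⟩⟩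
    · rw [Function.update_of_ne hx, decide_eq_decide]
      refine and_congr_right fun _ => ⟨?_, ?_⟩
      · rintro ⟨s, hs, h⟩
        refine ⟨s, lt_of_le_of_ne (by simpa using hs) ?_, h⟩
        rintro rfl
        exact hx h.symm
      · rintro ⟨s, hs, h⟩
        exact ⟨s, hs.trans (lt_add_one t), h⟩
  head_limit l _ hl := OTMProgram.head_limit hl i
  tape_limit l _ hl x := by
    apply liminf_Iio_bool_eq
    simp only [decide_eq_true_iff]
    constructor
    · rintro ⟨h, s, hs, hx⟩
      refine (eventually_Iio_iff hl).2 ⟨s + 1, hl.add_one_lt hs, fun t _ ht => ⟨h, s, ?_, hx⟩⟩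
      exact (lt_add_one s).trans_le ht
    · intro h
      have := nonempty_Iio_of_isSuccLimit hl
      obtain ⟨t, h, s, hs, hx⟩ := h.exists
      exact ⟨h, s, hs.trans t.2, hx⟩

open Classical in
theorem scan_mark (f : Ordinal.{u} → Bool) (t : Ordinal.{u}) :
    (mark α P i f).scan t = decide (f ((P.run t).head i) = true ∧
      ∃ s < t, (P.run s).head i = (P.run t).head i) := rfl

/-- The cells of tape `i` whose positions are in the residue class `k`. -/
noncomputable def residueClass (k : Fin 3) : TapeTrace α where
  head t := window k ((P.run t).head i)
  tape t x := (P.run t).tape i (positionOf k x)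
  write t := if residue ((P.run t).head i) = k then (P.actionAt t).write i
    else (P.run t).tape i (positionOf k (window k ((P.run t).head i)))
  move t := windowMove k ((P.actionAt t).move i) ((P.run t).head i)
  head_zero := by rw [P.head_zero, window_zero]
  tape_zero x := P.tape_zero i _
  head_succ t _ := by rw [windowMove_apply, P.head_add_one]
  tape_succ t _ := by
    funext x
    rw [P.tape_add_one]
    set p := (P.run t).head i with hp
    by_cases h : residue p = k
    · rw [if_pos h]
      subst h
      rcases eq_or_ne x (window (residue p) p) with rfl | hx
      · rw [positionOf_window_residue, Function.update_self, Function.update_self]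
      · rw [Function.update_of_ne hx, Function.update_of_ne]
        intro h
        apply hx
        conv_rhs => rw [← h]
        rw [← h, residue_positionOf, window_positionOf]
    · rw [if_neg h, Function.update_of_ne]
      · exact (congrFun (Function.update_eq_self
          (f := fun x => (P.run t).tape i (positionOf k x)) (window k p)) x).symm
      · intro h'
        exact h (by rw [← h', residue_positionOf])
  head_limit l _ hl := by
    rw [OTMProgram.head_limit hl]
    exact map_liminf_Iio hl (window_monotone k) (window_continuous k) _
  tape_limit l _ hl x := OTMProgram.tape_limit hl i _

/-- The first cell of tape `i`. -/
noncomputable def firstCell : TapeTrace α :=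
  flag (fun t => (P.run t).tape i 0) (P.tape_zero i 0)
    fun _ _ hl => OTMProgram.tape_limit_eq_true_iff hl i 0

/-- The bit `j < q` of the state `q`. -/
noncomputable def stateBit (hP : ∀ t ≤ α, (P.run t).state < P.numStates) (j : ℕ) : TapeTrace α :=
  flag (fun t => decide (j < (P.run t).state)) (by rw [P.run_zero]; simp [OTMProgram.init])
    fun l hlα hl => by
      simpa using OTMProgram.lt_state_limit_iff hl (fun s hs => hP s (hs.le.trans hlα)) j

/-- The parity of the time. -/
noncomputable def parity : TapeTrace α :=
  flag timeParity timeParity_zero fun l _ hl => by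
    rw [timeParity_of_isSuccLimit hl]
    simpa using not_eventually_of_alternating hl (p := fun t => timeParity t = true)
      fun t h => by simp [timeParity_add_one, h]

open Classical in
/-- Whether the computation has left its initial configuration. -/
noncomputable def started : TapeTrace α :=
  flag (fun t => decide (t ≠ 0)) (by simp) fun l _ hl => by
    have h := hl.bot_lt
    refine iff_of_true (by simpa using h.ne') ((eventually_Iio_iff hl).2
      ⟨1, by simpa using hl.add_one_lt h, fun s _ hs => ?_⟩)
    simpa using (zero_lt_one.trans_le hs).ne'

open Classical in
/-- The information about the position of head `i` directly after a move to the right, at the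
times of parity `c`. -/
noncomputable def arrival (c : Bool) (j : Fin 5) : TapeTrace α :=
  flag (fun t => decide (timeParity t = c ∧ ∃ s, t = s + 1 ∧
      (P.run t).head i = (P.run s).head i + 1 ∧ positionInfo j ((P.run t).head i) = true))
    (decide_eq_false fun h => h.2.elim fun s hs => not_exists_zero_eq_add_one ⟨s, hs.1⟩)
    fun l _ hl => by
      simp only [decide_eq_true_iff]
      refine iff_of_false (fun h => h.2.elim fun s hs => not_exists_eq_add_one_of_isSuccLimit hl
        ⟨s, hs.1⟩) ?_
      refine not_eventually_of_alternating hl (p := fun t => timeParity t = c ∧ ∃ s, t = s + 1 ∧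
        (P.run t).head i = (P.run s).head i + 1 ∧ positionInfo j ((P.run t).head i) = true) ?_
      -- A single record could stay `1` through an unbroken run of right moves and be wrong at the
      -- limit; fixing the parity clears it at every other step.
      rintro t ⟨h, -⟩ ⟨h', -⟩
      rw [timeParity_add_one, h] at h'
      exact Bool.not_ne_self c h'

end TapeTrace

/-! ### Recovering the local situation from the scanned symbols. -/

/-- The tapes of the real-time simulation of `P` with lookahead. -/
abbrev LookaheadIndex (P : OTMProgram) : Type :=
  (Fin P.numStates ⊕ Bool) ⊕
    Fin P.numTapes × ((Unit ⊕ Fin 3) ⊕ (Fin 5 ⊕ Bool × Fin 5))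

namespace OTMProgram

variable {P : OTMProgram} {α t t' : Ordinal.{u}}

/-- The traces of the tapes of the real-time simulation of `P` with lookahead. -/
noncomputable def lookaheadTrace (hP : ∀ t ≤ α, (P.run t).state < P.numStates) :
    LookaheadIndex P → TapeTrace α
  | .inl (.inl j) => .stateBit α P hP j
  | .inl (.inr true) => .parity α
  | .inl (.inr false) => .started α
  | .inr (i, .inl (.inl _)) => .firstCell α P i
  | .inr (i, .inl (.inr k)) => .residueClass α P i k
  | .inr (i, .inr (.inl j)) => .mark α P i (positionInfo j)
  | .inr (i, .inr (.inr (c, j))) => .arrival α P i c j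

open Classical in
/-- The position of a head can be learned from its mark, from the record of its arrival, or from
the fact that the computation has just begun. -/
theorem positionInfo_head_eq (i : Fin P.numTapes) (j : Fin 5) (t : Ordinal.{u}) :
    positionInfo j ((P.run t).head i) =
      ((TapeTrace.mark α P i (positionInfo j)).scan t ||
        (TapeTrace.arrival α P i true j).scan t || (TapeTrace.arrival α P i false j).scan t ||
        (!(TapeTrace.started α).scan t && positionInfo j (0 : Ordinal.{u}))) := by
  simp only [TapeTrace.arrival, TapeTrace.started, TapeTrace.scan_flag, TapeTrace.scan_mark]
  rw [Bool.eq_iff_iff]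
  simp only [Bool.or_eq_true, Bool.and_eq_true, decide_eq_true_iff, Bool.not_eq_true',
    decide_eq_false_iff_not, not_not]
  constructor
  · intro h
    rcases Ordinal.zero_or_succ_or_isSuccLimit t with rfl | ⟨s, rfl⟩ | hl
    · rw [P.head_zero] at h
      exact Or.inr ⟨rfl, h⟩
    · simp only [succ_eq_add_one] at *
      left
      have hlt := lt_add_one s
      -- A left move ends on `0` or on a predecessor, both visited earlier, so only a right move can
      -- reach a new cell.
      have hvisited : (∃ r < s + 1, (P.run r).head i = (P.run (s + 1)).head i) ∨
          (P.run (s + 1)).head i = (P.run s).head i + 1 := by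
        rw [P.head_add_one]
        rcases (P.actionAt s).move i with _ | _ | _
        · left
          rcases Ordinal.zero_or_succ_or_isSuccLimit ((P.run s).head i) with h | ⟨q, h⟩ | h
          · exact ⟨s, hlt, by rw [h, HeadMove.apply_left_zero]⟩
          · simp only [succ_eq_add_one] at h
            obtain ⟨r, hr, h'⟩ := exists_head_eq_of_head_eq_add_one i s q h.symm
            exact ⟨r, hr.trans hlt, by rw [h', ← h, HeadMove.apply_left_add_one]⟩
          · exact ⟨0, zero_le.trans_lt hlt, by
              rw [P.head_zero, HeadMove.apply_left_of_isSuccLimit h]⟩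
        · exact Or.inl ⟨s, hlt, rfl⟩
        · exact Or.inr rfl
      rcases hvisited with h' | h'
      · exact Or.inl (Or.inl ⟨h, h'⟩)
      · rcases hc : timeParity (s + 1)
        · exact Or.inr ⟨rfl, s, rfl, h', h⟩
        · exact Or.inl (Or.inr ⟨rfl, s, rfl, h', h⟩)
    -- At a limit time a position with a bit equal to `1` is `0` or a successor, hence already
    -- marked.
    · refine Or.inl (Or.inl (Or.inl ⟨h, ?_⟩))
      rcases Ordinal.zero_or_succ_or_isSuccLimit ((P.run t).head i) with h' | ⟨q, h'⟩ | h'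
      · exact ⟨0, hl.bot_lt, by rw [h', P.head_zero]⟩
      · simp only [succ_eq_add_one] at h'
        obtain ⟨s, hs, h''⟩ := exists_head_eq_of_head_limit_eq_add_one hl i h'.symm
        exact ⟨s, hs, h''.trans h'⟩
      · rw [positionInfo_of_isSuccLimit j h'] at h
        exact absurd h Bool.false_ne_true
  · rintro (((h | ⟨-, s, -, -, h⟩) | ⟨-, s, -, -, h⟩) | ⟨rfl, h⟩)
    · exact h.1
    · exact h
    · exact h
    · rwa [P.head_zero]

/-- Two times at which `P` is in the same local situation, as far as its next two steps are
concerned. -/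
structure LocallyEq (P : OTMProgram) (t t' : Ordinal.{u}) : Prop where
  state : (P.run t).state = (P.run t').state
  parity : timeParity t = timeParity t'
  info : ∀ i j, positionInfo j ((P.run t).head i) = positionInfo j ((P.run t').head i)
  first : ∀ i, (P.run t).tape i 0 = (P.run t').tape i 0
  near : ∀ i k, (P.run t).tape i (positionOf k (window k ((P.run t).head i))) =
    (P.run t').tape i (positionOf k (window k ((P.run t').head i)))

theorem locallyEq_of_scan_eq (hP : ∀ t ≤ α, (P.run t).state < P.numStates) (ht : t ≤ α)
    (ht' : t' ≤ α)
    (h : ∀ i, (lookaheadTrace hP i).scan t = (lookaheadTrace hP i).scan t') :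
    P.LocallyEq t t' where
  state := by
    have hbit : ∀ j < P.numStates, j < (P.run t).state ↔ j < (P.run t').state := by
      intro j hj
      have := h (.inl (.inl ⟨j, hj⟩))
      simp only [lookaheadTrace, TapeTrace.stateBit, TapeTrace.scan_flag] at this
      exact decide_eq_decide.1 this
    apply le_antisymm <;> by_contra! hlt
    · exact lt_irrefl _ ((hbit _ (hP t' ht')).1 hlt)
    · exact lt_irrefl _ ((hbit _ (hP t ht)).2 hlt)
  parity := by
    have := h (.inl (.inr true))
    simpa only [lookaheadTrace, TapeTrace.parity, TapeTrace.scan_flag] using this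
  info i j := by
    rw [positionInfo_head_eq (α := α), positionInfo_head_eq (α := α)]
    have h1 := h (.inr (i, .inr (.inl j)))
    have h2 := h (.inr (i, .inr (.inr (true, j))))
    have h3 := h (.inr (i, .inr (.inr (false, j))))
    have h4 := h (.inl (.inr false))
    simp only [lookaheadTrace] at h1 h2 h3 h4
    rw [h1, h2, h3, h4]
  first i := by
    have := h (.inr (i, .inl (.inl ())))
    simpa only [lookaheadTrace, TapeTrace.firstCell, TapeTrace.scan_flag] using this
  near i k := h (.inr (i, .inl (.inr k)))

namespace LocallyEq

theorem scanned_eq (h : P.LocallyEq t t') : P.scanned t = P.scanned t' := by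
  funext i
  have h1 := h.near i (residue ((P.run t).head i))
  rw [positionOf_window_residue, residue_congr (h.info i), positionOf_window_residue] at h1
  exact h1

theorem actionAt_eq (h : P.LocallyEq t t') : P.actionAt t = P.actionAt t' := by
  rw [actionAt, actionAt, h.state, h.scanned_eq]

/-- The next scanned symbol is the one just written, a neighbour seen through a window, or the first
cell after a left move from a limit. -/
theorem scanned_add_one_eq (h : P.LocallyEq t t') : P.scanned (t + 1) = P.scanned (t' + 1) := by
  funext i
  have hinfo := h.info i
  have hnear := h.near i
  have hfirst := h.first i
  rw [scanned, scanned, P.head_add_one, P.head_add_one, P.tape_add_one, P.tape_add_one,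
    h.actionAt_eq]
  generalize (P.run t).head i = p at *
  generalize (P.run t').head i = p' at *
  rcases (P.actionAt t').move i with _ | _ | _
  · rcases Ordinal.zero_or_succ_or_isSuccLimit p with rfl | ⟨q, rfl⟩ | hl
    · rw [(eq_zero_congr hinfo).1 rfl]
      simp
    · simp only [succ_eq_add_one] at *
      obtain ⟨q', rfl⟩ := (isSucc_congr hinfo).1 ⟨q, rfl⟩
      rw [HeadMove.apply_left_add_one, HeadMove.apply_left_add_one,
        Function.update_of_ne (lt_add_one q).ne, Function.update_of_ne (lt_add_one q').ne]
      have h1 := hnear (residue q)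
      have h2 : residue q = residue q' := by
        have := residue_congr hinfo
        rwa [residue_add_one, residue_add_one, add_left_inj] at this
      rwa [positionOf_window_residue_pred, h2, positionOf_window_residue_pred] at h1
    · have hn := not_exists_eq_add_one_of_isSuccLimit hl
      rcases Ordinal.zero_or_succ_or_isSuccLimit p' with rfl | ⟨q', rfl⟩ | hl'
      · exact absurd ((eq_zero_congr hinfo).2 rfl) hl.bot_lt.ne'
      · exact absurd ((isSucc_congr hinfo).2 ⟨q', rfl⟩) hn
      · rw [HeadMove.apply_left_of_isSuccLimit hl, HeadMove.apply_left_of_isSuccLimit hl',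
          Function.update_of_ne (show 0 < p from hl.bot_lt).ne,
          Function.update_of_ne (show 0 < p' from hl'.bot_lt).ne]
        exact hfirst
  · simp
  · rw [HeadMove.apply_right, HeadMove.apply_right, Function.update_of_ne (lt_add_one p).ne',
      Function.update_of_ne (lt_add_one p').ne']
    have h1 := hnear (residue (p + 1))
    have h2 : residue (p + 1) = residue (p' + 1) := by
      rw [residue_add_one, residue_add_one, residue_congr hinfo]
    rwa [positionOf_window_residue_succ, h2, positionOf_window_residue_succ] at h1

theorem state_add_one_eq (h : P.LocallyEq t t') :
    (P.run (t + 1)).state = (P.run (t' + 1)).state := by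
  rw [P.state_add_one, P.state_add_one, h.actionAt_eq]

theorem state_add_two_eq (h : P.LocallyEq t t') :
    (P.run (t + 1 + 1)).state = (P.run (t' + 1 + 1)).state := by
  rw [P.state_add_one, P.state_add_one, actionAt, actionAt, h.state_add_one_eq,
    h.scanned_add_one_eq]

theorem write_eq (h : P.LocallyEq t t') (hP : ∀ t ≤ α, (P.run t).state < P.numStates)
    (x : LookaheadIndex P) :
    (lookaheadTrace hP x).write t = (lookaheadTrace hP x).write t' := by
  match x with
  | .inl (.inl j) =>
    simp only [lookaheadTrace, TapeTrace.stateBit, TapeTrace.flag, h.state_add_one_eq]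
  | .inl (.inr true) =>
    simp only [lookaheadTrace, TapeTrace.parity, TapeTrace.flag, timeParity_add_one, h.parity]
  | .inl (.inr false) =>
    simp [lookaheadTrace, TapeTrace.started, TapeTrace.flag]
  | .inr (i, .inl (.inl _)) =>
    simp only [lookaheadTrace, TapeTrace.firstCell, TapeTrace.flag, P.tape_add_one,
      h.actionAt_eq, Function.update_apply, h.first i, eq_comm (a := (0 : Ordinal.{u})),
      eq_zero_congr (h.info i)]
  | .inr (i, .inl (.inr k)) =>
    simp only [lookaheadTrace, TapeTrace.residueClass, h.actionAt_eq, h.near i k,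
      residue_congr (h.info i)]
  | .inr (i, .inr (.inl j)) => exact h.info i j
  | .inr (i, .inr (.inr (c, j))) =>
    -- The arrival record of time `s + 1` is expressed by data available at time `s`.
    have key : ∀ s : Ordinal.{u}, (timeParity (s + 1) = c ∧ ∃ r, s + 1 = r + 1 ∧
        (P.run (s + 1)).head i = (P.run r).head i + 1 ∧
        positionInfo j ((P.run (s + 1)).head i) = true) ↔
        (!timeParity s) = c ∧ (P.actionAt s).move i = .right ∧
          positionInfo j ((P.run s).head i + 1) = true := by
      intro s
      rw [timeParity_add_one, P.head_add_one]
      refine and_congr_right fun _ => ⟨?_, fun h => ⟨s, rfl, ?_⟩⟩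
      · rintro ⟨r, hr, h1, h2⟩
        obtain rfl : s = r := by simpa using hr
        rw [h1] at h2
        exact ⟨(HeadMove.apply_eq_add_one_iff _ _).1 h1, h2⟩
      · rw [h.1]
        exact ⟨rfl, h.2⟩
    simp only [lookaheadTrace, TapeTrace.arrival, TapeTrace.flag, decide_eq_decide]
    rw [key, key, h.parity, h.actionAt_eq, positionInfo_add_one_congr (h.info i)]

theorem move_eq (h : P.LocallyEq t t') (hP : ∀ t ≤ α, (P.run t).state < P.numStates)
    (x : LookaheadIndex P) :
    (lookaheadTrace hP x).move t = (lookaheadTrace hP x).move t' := by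
  match x with
  | .inl (.inl j) => rfl
  | .inl (.inr true) => rfl
  | .inl (.inr false) => rfl
  | .inr (i, .inl (.inl _)) => rfl
  | .inr (i, .inl (.inr k)) =>
    simp only [lookaheadTrace, TapeTrace.residueClass, h.actionAt_eq,
      windowMove_congr (h.info i)]
  | .inr (i, .inr (.inl j)) =>
    simp only [lookaheadTrace, TapeTrace.mark, h.actionAt_eq]
  | .inr (i, .inr (.inr (c, j))) => rfl

end LocallyEq

end OTMProgram

/-- The event that `P` halts two steps later is readable from the current symbols and first occurs
at time `α`. -/
theorem OTMClockable.of_add_one {α : Ordinal.{u}} (h : OTMClockable (α + 1)) :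
    OTMClockable α := by
  obtain ⟨P, hhalt, hwork⟩ := h
  have hP : ∀ t ≤ α, (P.run t).state < P.numStates := fun t ht =>
    hwork t (ht.trans_lt ((lt_add_one α).trans (lt_add_one _)))
  have : Nonempty (LookaheadIndex P) := ⟨.inl (.inr true)⟩
  refine otmClockable_of_tapeTraces (OTMProgram.lookaheadTrace hP)
    (fun t => P.numStates ≤ (P.run (t + 1 + 1)).state) (fun t ht t' ht' hscan => ?_) hhalt
    fun t ht => ?_
  · have hl := OTMProgram.locallyEq_of_scan_eq hP ht ht' hscan
    exact ⟨fun x => ⟨hl.write_eq hP x, hl.move_eq hP x⟩, fun h => hl.state_add_two_eq ▸ h⟩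
  · rw [not_le]
    exact hwork _ (by simpa using ht)

theorem mainTheorem10 (α : Ordinal.{u}) (n : ℕ) (h : OTMClockable (α + (n : Ordinal.{u}))) :
    OTMClockable α := by
  induction n with
  | zero => simpa using h
  | succ n ih =>
    rw [Nat.cast_add_one, ← add_assoc] at h
    exact ih h.of_add_one
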